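/- All graphs are finite and simple, and cycles are disjoint if they share no vertex. Let $G$ be a graph with a perfect matching. A set $S\subseteq E(G)$ is a global forcing set of $G$ if no two distinct perfect matchings $M,N$ of $G$ satisfy $M\cap S=N\cap S$; the global forcing number $gf(G)$ is the minimum cardinality of a global forcing set of $G$. For a perfect matching $M$ of $G$, an anti-forcing set of $M$ is a set $S\subseteq E(G)\setminus M$ such that $G-S$ has a unique perfect matching; $af(G,M)$ is the minimum cardinality of an anti-forcing set of $M$, and $Af(G)$, the maximum anti-forcing number of $G$, is the maximum of $af(G,M)$ over all perfect matchings $M$ of $G$. Let $\mathcal{G}$ be the class of all graphs $G$ that have a perfect matching and contain no two disjoint odd cycles $C$ and $C'$ such that $G-C-C'$, the graph obtained from $G$ by deleting all vertices of $C$ and $C'$, has a perfect matching (the graph with no vertices counts as having the empty perfect matching). **Theorem.** If $G\in\mathcal{G}$, then $gf(G)\ge Af(G)$. -/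

import Mathlib

namespace SimpleGraph

variable {V : Type*}

/-- The graph has at least one perfect matching. -/
def HasPerfectMatching (G : SimpleGraph V) : Prop :=
  ∃ M : G.Subgraph, M.IsPerfectMatching

/-- An edge subset `S` of `G` is a global forcing set if no two distinct perfect matchings
of `G` coincide on `S`. -/
def IsGlobalForcingSet (G : SimpleGraph V) (S : Set (Sym2 V)) : Prop :=
  S ⊆ G.edgeSet ∧
    ∀ M N : G.Subgraph, M.IsPerfectMatching → N.IsPerfectMatching →
      M.edgeSet ∩ S = N.edgeSet ∩ S → M = N

/-- The global forcing number `gf(G)`: the minimum size of a global forcing set. -/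
noncomputable def globalForcingNumber (G : SimpleGraph V) : ℕ :=
  sInf {k : ℕ | ∃ S : Set (Sym2 V), G.IsGlobalForcingSet S ∧ S.ncard = k}

/-- A set `S ⊆ E(G) \ M` is an anti-forcing set of the perfect matching `M` if `G - S` has a
unique perfect matching. -/
def IsAntiForcingSet (G : SimpleGraph V) (M : G.Subgraph) (S : Set (Sym2 V)) : Prop :=
  S ⊆ G.edgeSet \ M.edgeSet ∧ ∃! N : (G.deleteEdges S).Subgraph, N.IsPerfectMatching

/-- The anti-forcing number `af(G, M)`: the minimum size of an anti-forcing set of `M`. -/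
noncomputable def antiForcingNumber (G : SimpleGraph V) (M : G.Subgraph) : ℕ :=
  sInf {k : ℕ | ∃ S : Set (Sym2 V), G.IsAntiForcingSet M S ∧ S.ncard = k}

/-- The maximum anti-forcing number `Af(G)`: the maximum of `af(G, M)` over all perfect
matchings `M` of `G`. -/
noncomputable def maxAntiForcingNumber (G : SimpleGraph V) : ℕ :=
  sSup {k : ℕ | ∃ M : G.Subgraph, M.IsPerfectMatching ∧ G.antiForcingNumber M = k}

/-- `G` contains two disjoint odd cycles `C`, `C'` such that `G - C - C'` (the subgraph induced
on the vertices outside `C` and `C'`, possibly with no vertices) has a perfect matching. -/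
def HasConformalOddCyclePair (G : SimpleGraph V) : Prop :=
  ∃ (u v : V) (C : G.Walk u u) (C' : G.Walk v v),
    C.IsCycle ∧ C'.IsCycle ∧ Odd C.length ∧ Odd C'.length ∧
      C.support.Disjoint C'.support ∧
      (G.induce {x | x ∉ C.support ∧ x ∉ C'.support}).HasPerfectMatching

/-- The class of graphs with a perfect matching that contain no two disjoint odd cycles whose
deletion leaves a graph with a perfect matching. -/
def InClassG (G : SimpleGraph V) : Prop :=
  G.HasPerfectMatching ∧ ¬ G.HasConformalOddCyclePair

/-- The minimum defining `gf(G)` is over a nonempty set. -/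
theorem isGlobalForcingSet_edgeSet (G : SimpleGraph V) : G.IsGlobalForcingSet G.edgeSet := by
  refine ⟨subset_rfl, fun M N hM hN h => ?_⟩
  rw [Set.inter_eq_left.2 M.edgeSet_subset, Set.inter_eq_left.2 N.edgeSet_subset] at h
  refine Subgraph.ext ?_ ?_
  · rw [hM.2.verts_eq_univ, hN.2.verts_eq_univ]
  · funext a b
    have := congrArg (s(a, b) ∈ ·) h
    simpa using this

/-- The minimum defining `af(G, M)` is over a nonempty set. -/
theorem isAntiForcingSet_compl (G : SimpleGraph V) (M : G.Subgraph) (hM : M.IsPerfectMatching) :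
    G.IsAntiForcingSet M (G.edgeSet \ M.edgeSet) := by
  refine ⟨subset_rfl, ?_⟩
  have key : ∀ a b, (G.deleteEdges (G.edgeSet \ M.edgeSet)).Adj a b ↔ M.Adj a b := by
    intro a b
    simp only [deleteEdges_adj, Set.mem_sdiff, mem_edgeSet, Subgraph.mem_edgeSet]
    have := @Subgraph.adj_sub _ _ M a b
    tauto
  have hM' := Subgraph.isPerfectMatching_iff.1 hM
  refine ⟨⊤, Subgraph.isPerfectMatching_iff.2 fun v => ?_, fun N hN => ?_⟩
  · simpa only [Subgraph.top_adj, key] using hM' v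
  · refine Subgraph.ext (by simp [hN.2.verts_eq_univ]) ?_
    funext a b
    refine propext ⟨fun h => by simpa using N.adj_sub h, fun h => ?_⟩
    obtain ⟨c, hc, -⟩ := Subgraph.isPerfectMatching_iff.1 hN a
    have h1 : M.Adj a b := (key a b).1 (by simpa using h)
    have h2 : M.Adj a c := (key a c).1 (N.adj_sub hc)
    rwa [(hM' a).unique h1 h2]

/-- The maximum defining `Af(G)` is over a finite set. -/
theorem finite_antiForcingNumbers [Finite V] (G : SimpleGraph V) :
    {k : ℕ | ∃ M : G.Subgraph, M.IsPerfectMatching ∧ G.antiForcingNumber M = k}.Finite :=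
  (Set.toFinite (Set.range G.antiForcingNumber)).subset fun _ ⟨M, _, h⟩ => ⟨M, h⟩

end SimpleGraph

/-!
Fix a perfect matching `M` of `G` and a global forcing set `S`; an anti-forcing set of `M` with at
most `|S|` edges is produced by induction on the number of edges of `G`
(`exists_antiforcing_of_forcing`).

An edge in no perfect matching can be deleted at no cost. When no such edge is left, the vertices
of degree at least two form a union of connected components. If one of them, `u`, is incident with
at most one edge outside `S`, then delete the edges at `u` other than the `M`-edge: their number
`deg u - 1` is at most the number of edges of `S` at `u`, and the edges of `S` away from `u` still
tell apart the perfect matchings of the smaller graph, since these all agree at `u`.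

Such a `u` exists. Choose a perfect matching `M'` with as many edges outside `S` as possible, and
let `H` consist of `M'` and all edges outside `S`. A perfect matching of `H` has at least as many
edges outside `S` as `M'`, so by maximality it agrees with `M'` on `S` and hence equals `M'`:
the perfect matching of `H` is unique. If every vertex of degree at least two had two edges
outside `S`, a longest `M'`-alternating path of `H` starting and ending with `M'`-edges would have
at both ends a further edge of `H` back to the path. These two edges close either an
`M'`-alternating cycle, against uniqueness, or two disjoint odd cycles, one at each end
of the path, such that the part of the path between them and the rest of the graph are perfectly
matched (`hasConformalOddCyclePair_of_unique`); the latter is excluded in the class considered.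
-/

namespace SimpleGraph

/-! ### Perfect matchings as mate functions -/

/-- `m` sends each vertex of `X` to its partner in a perfect matching of `G` on the vertex
set `X`; the values of `m` outside `X` are irrelevant. -/
def IsMateOn {V : Type*} (G : SimpleGraph V) (X : Set V) (m : V → V) : Prop :=
  ∀ v ∈ X, m v ∈ X ∧ G.Adj v (m v) ∧ m (m v) = v

/-- A perfect matching of `G`, encoded as the fixed-point-free involution that sends each vertex
to its partner. -/
def IsMate {V : Type*} (G : SimpleGraph V) (m : V → V) : Prop :=
  ∀ v, G.Adj v (m v) ∧ m (m v) = v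

section Mates

variable {V : Type*} {G H : SimpleGraph V} {m m' : V → V}

theorem IsMate.mono (hGH : G ≤ H) (h : G.IsMate m) : H.IsMate m :=
  fun v => ⟨hGH (h v).1, (h v).2⟩

/-- The perfect matching encoded by a mate function, as a subgraph. -/
def IsMate.toSubgraph (h : G.IsMate m) : G.Subgraph where
  verts := Set.univ
  Adj a b := m a = b
  adj_sub := by
    rintro a b rfl
    exact (h a).1
  edge_vert _ := Set.mem_univ _
  symm := ⟨by
    rintro a b rfl
    exact (h a).2⟩

theorem IsMate.isPerfectMatching (h : G.IsMate m) : h.toSubgraph.IsPerfectMatching :=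
  Subgraph.isPerfectMatching_iff.2 fun v => ⟨m v, rfl, fun _ hb => Eq.symm hb⟩

theorem IsMate.mem_edgeSet (h : G.IsMate m) {e : Sym2 V} :
    e ∈ h.toSubgraph.edgeSet ↔ ∃ v, e = s(v, m v) := by
  induction e with
  | h a b =>
    rw [Subgraph.mem_edgeSet]
    constructor
    · rintro (rfl : m a = b)
      exact ⟨a, rfl⟩
    · rintro ⟨v, hv⟩
      change m a = b
      rcases Sym2.eq_iff.1 hv with ⟨rfl, rfl⟩ | ⟨rfl, rfl⟩
      · rfl
      · exact (h b).2

theorem Subgraph.IsPerfectMatching.exists_isMate {M : G.Subgraph} (hM : M.IsPerfectMatching) :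
    ∃ m, G.IsMate m ∧ ∀ a b, M.Adj a b ↔ m a = b := by
  have hM' := Subgraph.isPerfectMatching_iff.1 hM
  choose m hm hu using hM'
  refine ⟨m, fun v => ⟨M.adj_sub (hm v), (hu _ _ (hm v).symm).symm⟩, fun a b => ⟨fun h => ?_, ?_⟩⟩
  · exact (hu a b h).symm
  · rintro rfl
    exact hm a

theorem IsMateOn.hasPerfectMatching_induce {X : Set V} (h : G.IsMateOn X m) :
    (G.induce X).HasPerfectMatching := by
  have h' : (G.induce X).IsMate fun v => ⟨m v, (h v v.2).1⟩ :=
    fun v => ⟨(h v v.2).2.1, Subtype.ext (h v v.2).2.2⟩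
  exact ⟨_, h'.isPerfectMatching⟩

theorem IsMateOn.exists_union {X Y : Set V} (hXY : Disjoint X Y) (h : G.IsMateOn X m)
    (h' : G.IsMateOn Y m') :
    ∃ n, G.IsMateOn (X ∪ Y) n ∧ Set.EqOn n m X := by
  classical
  refine ⟨fun v => if v ∈ X then m v else m' v, ?_, fun v hv => if_pos hv⟩
  rintro v (hv | hv)
  · have := h v hv
    simp [hv, this.1, this.2.1, this.2.2]
  · have := h' v hv
    have h1 : v ∉ X := fun hx => Set.disjoint_left.1 hXY hx hv
    have h2 : m' v ∉ X := fun hx => Set.disjoint_left.1 hXY hx this.1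
    simp [h1, h2, this.1, this.2.1, this.2.2]

/-- An involution `σ` of the indices matches the vertices of an injective family. -/
theorem exists_isMateOn_image {f : ℕ → V} {I : Set ℕ} {σ : ℕ → ℕ} (hf : I.InjOn f)
    (hσ : ∀ a ∈ I, σ a ∈ I ∧ σ (σ a) = a ∧ G.Adj (f a) (f (σ a))) :
    ∃ n, G.IsMateOn (f '' I) n ∧ ∀ a ∈ I, n (f a) = f (σ a) := by
  have key : ∀ a ∈ I, Function.invFunOn f I (f a) = a := fun a ha => hf.leftInvOn_invFunOn ha
  have key' : ∀ a ∈ I, f (σ (Function.invFunOn f I (f a))) = f (σ a) := fun a ha => by rw [key a ha]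
  refine ⟨fun v => f (σ (Function.invFunOn f I v)), ?_, key'⟩
  rintro _ ⟨a, ha, rfl⟩
  obtain ⟨h1, h2, h3⟩ := hσ a ha
  simp only [key a ha, key _ h1, h2]
  exact ⟨⟨_, h1, rfl⟩, h3, trivial⟩

theorem IsMate.isMateOn_compl (hm : G.IsMate m) {X : Set V} (hX : ∀ v ∈ X, m v ∈ X) :
    G.IsMateOn Xᶜ m := fun v hv =>
  ⟨fun hmv => hv ((hm v).2 ▸ hX _ hmv), hm v⟩

/-- A set closed under a perfect matching can be rematched arbitrarily inside. -/
theorem IsMate.exists_rematch (hm : G.IsMate m) {X : Set V} (hX : ∀ v ∈ X, m v ∈ X)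
    (h : G.IsMateOn X m') : ∃ n, G.IsMate n ∧ Set.EqOn n m' X := by
  obtain ⟨n, hn, he⟩ := h.exists_union disjoint_compl_right (hm.isMateOn_compl hX)
  rw [Set.union_compl_self] at hn
  exact ⟨n, fun v => (hn v trivial).2, he⟩

end Mates

/-! ### Alternating paths in a graph with a unique perfect matching -/

section Paths

variable {V : Type*} {G H : SimpleGraph V} {m : V → V} {A : Set V} {f : ℕ → V} {k : ℕ}

theorem HasConformalOddCyclePair.mono (hGH : G ≤ H) (h : G.HasConformalOddCyclePair) :
    H.HasConformalOddCyclePair := by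
  obtain ⟨u, v, C, C', hC, hC', ho, ho', hd, M, hM⟩ := h
  refine ⟨u, v, C.mapLe hGH, C'.mapLe hGH, hC.mapLe hGH, hC'.mapLe hGH, by simpa, by simpa,
    by simpa [Walk.support_map] using hd, ?_⟩
  obtain ⟨n, hn, -⟩ := hM.exists_isMate
  have hle : G.induce {x | x ∉ C.support ∧ x ∉ C'.support} ≤
      H.induce {x | x ∉ C.support ∧ x ∉ C'.support} := fun a b hab => hGH hab
  have := (hn.mono hle).isPerfectMatching
  have hs : {x | x ∉ (C.mapLe hGH).support ∧ x ∉ (C'.mapLe hGH).support} =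
      {x | x ∉ C.support ∧ x ∉ C'.support} := by simp [Walk.support_map]
  rw [hs]
  exact ⟨_, this⟩

/-- An injective run of consecutively adjacent vertices, traversed as a path. -/
theorem exists_isPath_of_injOn (a n : ℕ) (hf : (Set.Icc a (a + n)).InjOn f)
    (hadj : ∀ i, a ≤ i → i < a + n → G.Adj (f i) (f (i + 1))) :
    ∃ p : G.Walk (f a) (f (a + n)), p.IsPath ∧ p.length = n ∧
      (∀ v, v ∈ p.support ↔ v ∈ f '' Set.Icc a (a + n)) ∧
      ∀ e ∈ p.edges, ∃ i, a ≤ i ∧ i < a + n ∧ e = s(f i, f (i + 1)) := by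
  induction n with
  | zero => exact ⟨Walk.nil, by simp, rfl, by simp, by simp⟩
  | succ n ih =>
    obtain ⟨p, hp, hl, hs, he⟩ := ih (hf.mono (Set.Icc_subset_Icc_right (by omega)))
      fun i h1 h2 => hadj i h1 (by omega)
    refine ⟨p.concat (hadj (a + n) (by omega) (by omega)), ?_, ?_, ?_, ?_⟩
    · refine hp.concat ?_ _
      rw [hs]
      rintro ⟨i, hi, hie⟩
      simp only [Set.mem_Icc] at hi
      have := hf (Set.mem_Icc.2 ⟨hi.1, by omega⟩) (Set.mem_Icc.2 ⟨by omega, le_rfl⟩) hie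
      omega
    · simp [hl]
    · intro v
      rw [Walk.support_concat, List.mem_append, hs, List.mem_singleton]
      constructor
      · rintro (⟨i, hi, rfl⟩ | rfl)
        · exact ⟨i, ⟨hi.1, hi.2.trans (by omega)⟩, rfl⟩
        · exact ⟨_, ⟨by omega, le_rfl⟩, rfl⟩
      · rintro ⟨i, hi, rfl⟩
        simp only [Set.mem_Icc] at hi
        by_cases h : i = a + (n + 1)
        · exact Or.inr (by rw [h])
        · exact Or.inl ⟨i, ⟨hi.1, by omega⟩, rfl⟩
    · intro e hm
      rw [Walk.edges_concat, List.concat_eq_append, List.mem_append, List.mem_singleton] at hm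
      rcases hm with hm | rfl
      · obtain ⟨i, h1, h2, h3⟩ := he e hm
        exact ⟨i, h1, by omega, h3⟩
      · exact ⟨a + n, by omega, by omega, rfl⟩

theorem exists_isCycle_of_injOn {a b : ℕ} (hab : a + 2 ≤ b) (hf : (Set.Icc a b).InjOn f)
    (hadj : ∀ i, a ≤ i → i < b → G.Adj (f i) (f (i + 1))) (hclose : G.Adj (f b) (f a)) :
    ∃ C : G.Walk (f b) (f b), C.IsCycle ∧ C.length = b - a + 1 ∧
      ∀ v, v ∈ C.support ↔ v ∈ f '' Set.Icc a b := by
  obtain ⟨n, rfl⟩ := Nat.exists_eq_add_of_le (show a ≤ b by omega)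
  obtain ⟨p, hp, hl, hs, he⟩ := exists_isPath_of_injOn a n hf hadj
  refine ⟨Walk.cons hclose p, ?_, by simp [hl], fun v => ?_⟩
  · rw [Walk.cons_isCycle_iff]
    refine ⟨hp, fun hm => ?_⟩
    obtain ⟨i, h1, h2, h3⟩ := he _ hm
    have mem : ∀ j, a ≤ j → j ≤ a + n → j ∈ Set.Icc a (a + n) := fun j h h' => ⟨h, h'⟩
    rcases Sym2.eq_iff.1 h3 with ⟨h4, -⟩ | ⟨h4, h5⟩
    · have := hf (mem _ (by omega) le_rfl) (mem i h1 (by omega)) h4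
      omega
    · have := hf (mem _ (by omega) le_rfl) (mem (i + 1) (by omega) (by omega)) h4
      have := hf (mem _ le_rfl (by omega)) (mem i h1 (by omega)) h5
      omega
  · rw [Walk.support_cons, List.mem_cons, hs]
    refine ⟨?_, Or.inr⟩
    rintro (rfl | h)
    · exact ⟨_, ⟨by omega, le_rfl⟩, rfl⟩
    · exact h

/-- `f 0, f 1, …, f (2 * k + 1)` is a path of `H` inside `A` whose edges alternate between the
matching `m` and `H`, and whose first and last edges belong to the matching. -/
structure IsAltPath (H : SimpleGraph V) (m : V → V) (A : Set V) (k : ℕ) (f : ℕ → V) : Prop where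
  injOn : (Set.Icc 0 (2 * k + 1)).InjOn f
  mem : ∀ i ≤ 2 * k + 1, f i ∈ A
  mate : ∀ i ≤ k, m (f (2 * i)) = f (2 * i + 1)
  adj : ∀ i < k, H.Adj (f (2 * i + 1)) (f (2 * i + 2))

namespace IsAltPath

theorem inj (hp : IsAltPath H m A k f) {i j : ℕ} (hi : i ≤ 2 * k + 1) (hj : j ≤ 2 * k + 1)
    (h : f i = f j) : i = j :=
  hp.injOn ⟨Nat.zero_le _, hi⟩ ⟨Nat.zero_le _, hj⟩ h

theorem mate_even (hp : IsAltPath H m A k f) {i : ℕ} (hi : i ≤ 2 * k + 1) (he : i % 2 = 0) :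
    m (f i) = f (i + 1) := by
  obtain ⟨c, rfl⟩ : ∃ c, i = 2 * c := ⟨i / 2, by omega⟩
  exact hp.mate c (by omega)

theorem mate_odd (hm : H.IsMate m) (hp : IsAltPath H m A k f) {i : ℕ} (hi : i ≤ 2 * k + 1)
    (ho : i % 2 = 1) : m (f i) = f (i - 1) := by
  obtain ⟨c, rfl⟩ : ∃ c, i = 2 * c + 1 := ⟨i / 2, by omega⟩
  rw [← hp.mate c (by omega), (hm _).2, Nat.add_sub_cancel]

theorem adj_odd (hp : IsAltPath H m A k f) {i : ℕ} (hi : i < 2 * k + 1) (ho : i % 2 = 1) :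
    H.Adj (f i) (f (i + 1)) := by
  obtain ⟨c, rfl⟩ : ∃ c, i = 2 * c + 1 := ⟨i / 2, by omega⟩
  exact hp.adj c (by omega)

theorem adj_succ (hm : H.IsMate m) (hp : IsAltPath H m A k f) {i : ℕ} (hi : i < 2 * k + 1) :
    H.Adj (f i) (f (i + 1)) := by
  rcases Nat.mod_two_eq_zero_or_one i with h | h
  · exact hp.mate_even hi.le h ▸ (hm (f i)).1
  · exact hp.adj_odd hi h

theorem reverse (hm : H.IsMate m) (hp : IsAltPath H m A k f) :
    IsAltPath H m A k fun i => f (2 * k + 1 - i) where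
  injOn i hi j hj h := by
    simp only [Set.mem_Icc] at hi hj
    have := hp.inj (by omega) (by omega) h
    omega
  mem i hi := hp.mem _ (by omega)
  mate i hi := by
    rw [hp.mate_odd hm (by omega) (by omega)]
    congr 1
  adj i hi := by
    have := (hp.adj_odd (i := 2 * k + 1 - (2 * i + 2)) (by omega) (by omega)).symm
    rwa [show 2 * k + 1 - (2 * i + 2) + 1 = 2 * k + 1 - (2 * i + 1) by omega] at this

/-- At the end of a longest alternating path, every further edge inside `A` leads back
to the path. -/
theorem exists_adj_last (hm : H.IsMate m) (hp : IsAltPath H m A k f)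
    (hA : ∀ v ∈ A, m v ∈ A) (hA' : ∀ v ∈ A, ∃ z ∈ A, H.Adj v z ∧ z ≠ m v)
    (hmax : ¬ ∃ g, IsAltPath H m A (k + 1) g) :
    ∃ j < 2 * k, H.Adj (f (2 * k + 1)) (f j) := by
  obtain ⟨z, hz, hadj, hne⟩ := hA' _ (hp.mem (2 * k + 1) le_rfl)
  rw [hp.mate_odd hm le_rfl (by omega)] at hne
  by_cases hzf : ∃ j ≤ 2 * k + 1, f j = z
  · obtain ⟨j, hj, rfl⟩ := hzf
    refine ⟨j, ?_, hadj⟩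
    have h1 : j ≠ 2 * k + 1 := by
      rintro rfl
      exact hadj.ne rfl
    have h2 : j ≠ 2 * k := by
      rintro rfl
      exact hne rfl
    omega
  · -- Otherwise appending `z` and `m z` gives a longer alternating path.
    push Not at hzf
    have hmz : ∀ j ≤ 2 * k + 1, f j ≠ m z := by
      intro j hj h
      have h' : m (f j) = z := by rw [h, (hm z).2]
      rcases Nat.mod_two_eq_zero_or_one j with hj2 | hj2
      · exact hzf _ (by omega) ((hp.mate_even hj hj2).symm.trans h')
      · exact hzf _ (by omega) ((hp.mate_odd hm hj hj2).symm.trans h')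
    have hzm : z ≠ m z := (hm z).1.ne
    let g : ℕ → V := fun i => if i ≤ 2 * k + 1 then f i else if i = 2 * k + 2 then z else m z
    have g1 : ∀ i ≤ 2 * k + 1, g i = f i := fun i hi => if_pos hi
    have g2 : g (2 * k + 2) = z := by simp [g]
    have g3 : g (2 * k + 3) = m z := by simp [g]
    refine absurd ⟨g, ⟨?_, ?_, ?_, ?_⟩⟩ hmax
    · intro i hi j hj h
      simp only [Set.mem_Icc] at hi hj
      have cases : ∀ i ≤ 2 * (k + 1) + 1, i ≤ 2 * k + 1 ∨ i = 2 * k + 2 ∨ i = 2 * k + 3 := by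
        intro i hi
        omega
      rcases cases i hi.2 with hi | rfl | rfl <;> rcases cases j hj.2 with hj | rfl | rfl <;>
        try simp only [g2, g3] at h
      · exact hp.inj hi hj (by rwa [g1 i hi, g1 j hj] at h)
      · exact absurd (by rwa [g1 i hi] at h) (hzf i hi)
      · exact absurd (by rwa [g1 i hi] at h) (hmz i hi)
      · exact absurd (by rw [g1 j hj] at h; exact h.symm) (hzf j hj)
      · rfl
      · exact absurd h hzm
      · exact absurd (by rw [g1 j hj] at h; exact h.symm) (hmz j hj)
      · exact absurd h.symm hzm
      · rfl
    · intro i _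
      dsimp only [g]
      split_ifs with h1 h2
      · exact hp.mem i h1
      · exact hz
      · exact hA z hz
    · intro i hi
      rcases Nat.lt_or_ge k i with h | h
      · obtain rfl : i = k + 1 := by omega
        rw [show 2 * (k + 1) = 2 * k + 2 by ring, g2, g3]
      · rw [g1 _ (by omega), g1 _ (by omega), hp.mate i h]
    · intro i hi
      rcases Nat.lt_or_ge i k with h | h
      · rw [g1 _ (by omega), g1 _ (by omega)]
        exact hp.adj i h
      · obtain rfl : i = k := by omega
        rw [g1 _ le_rfl, g2]
        exact hadj

/-- Index sets that are unions of matching edges of the path span a set closed under the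
matching. -/
theorem mate_mem_image (hm : H.IsMate m) (hp : IsAltPath H m A k f) {I : Set ℕ}
    (hI : ∀ i ∈ I, i ≤ 2 * k + 1 ∧ (i % 2 = 0 → i + 1 ∈ I) ∧ (i % 2 = 1 → i - 1 ∈ I)) :
    ∀ v ∈ f '' I, m v ∈ f '' I := by
  rintro _ ⟨i, hi, rfl⟩
  obtain ⟨h1, h2, h3⟩ := hI i hi
  rcases Nat.mod_two_eq_zero_or_one i with h | h
  · exact ⟨_, h2 h, (hp.mate_even h1 h).symm⟩
  · exact ⟨_, h3 h, (hp.mate_odd hm h1 h).symm⟩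

/-- If the matching is unique, an edge from the last vertex of an alternating path back to the
path cannot close an alternating cycle. -/
theorem odd_of_adj_last (hm : H.IsMate m) (huniq : ∀ n, H.IsMate n → n = m)
    (hp : IsAltPath H m A k f) {j : ℕ} (hj : j < 2 * k) (hadj : H.Adj (f (2 * k + 1)) (f j)) :
    j % 2 = 1 := by
  by_contra hj2
  let σ : ℕ → ℕ := fun a => if a = j then 2 * k + 1 else if a = 2 * k + 1 then j else
    if a % 2 = 1 then a + 1 else a - 1
  have hI : (Set.Icc j (2 * k + 1)).InjOn f := hp.injOn.mono (Set.Icc_subset_Icc_left (by omega))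
  obtain ⟨n, hn, hn'⟩ := exists_isMateOn_image (G := H) (σ := σ) hI (by
    intro a ha
    simp only [Set.mem_Icc] at ha ⊢
    refine ⟨by grind, by grind, ?_⟩
    dsimp only [σ]
    split_ifs with h1 h2 h3
    · subst h1
      exact hadj.symm
    · subst h2
      exact hadj
    · exact hp.adj_odd (by omega) h3
    · have := (hp.adj_odd (i := a - 1) (by omega) (by omega)).symm
      rwa [Nat.sub_add_cancel (by omega)] at this)
  obtain ⟨n', hn1, hn2⟩ := hm.exists_rematch (hp.mate_mem_image hm (I := Set.Icc j (2 * k + 1)) (by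
    intro i hi
    simp only [Set.mem_Icc] at hi ⊢
    omega)) hn
  have hjI : j ∈ Set.Icc j (2 * k + 1) := ⟨le_rfl, by omega⟩
  have h1 : n' (f j) = f (2 * k + 1) := by
    rw [hn2 ⟨j, hjI, rfl⟩, hn' j hjI]
    simp [σ]
  rw [huniq n' hn1, hp.mate_even (by omega) (by omega)] at h1
  have := hp.inj (by omega) le_rfl h1
  omega

/-- If the matching is unique, the back edges at the two ends of an alternating path do not
cross. -/
theorem lt_of_adj_of_adj (hm : H.IsMate m) (huniq : ∀ n, H.IsMate n → n = m)
    (hp : IsAltPath H m A k f) {i j : ℕ} (hi : i ≤ 2 * k + 1) (hi2 : i % 2 = 0) (hj : j < 2 * k)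
    (hj2 : j % 2 = 1) (hadji : H.Adj (f 0) (f i)) (hadjj : H.Adj (f (2 * k + 1)) (f j)) :
    i < j := by
  by_contra hji
  -- The two outer segments of the path and the two back edges form an alternating cycle.
  let I : Set ℕ := {a | a ≤ j ∨ i ≤ a ∧ a ≤ 2 * k + 1}
  have memI : ∀ a, a ∈ I ↔ a ≤ j ∨ i ≤ a ∧ a ≤ 2 * k + 1 := fun _ => Iff.rfl
  let σ : ℕ → ℕ := fun a => if a = 0 then i else if a = i then 0 else if a = j then 2 * k + 1 else
    if a = 2 * k + 1 then j else if a % 2 = 1 then a + 1 else a - 1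
  have hσ : ∀ a, (a = 0 ∧ σ a = i) ∨ (a ≠ 0 ∧ a = i ∧ σ a = 0) ∨
      (a ≠ 0 ∧ a ≠ i ∧ a = j ∧ σ a = 2 * k + 1) ∨
      (a ≠ 0 ∧ a ≠ i ∧ a ≠ j ∧ a = 2 * k + 1 ∧ σ a = j) ∨
      (a ≠ 0 ∧ a ≠ i ∧ a ≠ j ∧ a ≠ 2 * k + 1 ∧ a % 2 = 1 ∧ σ a = a + 1) ∨
      (a ≠ 0 ∧ a ≠ i ∧ a ≠ j ∧ a ≠ 2 * k + 1 ∧ a % 2 = 0 ∧ σ a = a - 1) := by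
    intro a
    dsimp only [σ]
    split_ifs <;> omega
  have hI : I.InjOn f := hp.injOn.mono fun a ha => by
    rw [memI] at ha
    simp only [Set.mem_Icc]
    omega
  obtain ⟨n, hn, hn'⟩ := exists_isMateOn_image (G := H) (σ := σ) hI (by
    intro a ha
    rw [memI] at ha
    rw [memI]
    refine ⟨by have := hσ a; omega, by have := hσ a; have := hσ (σ a); omega, ?_⟩
    dsimp only [σ]
    split_ifs with h1 h2 h3 h4 h5
    · subst h1
      exact hadji
    · subst h2
      exact hadji.symm
    · subst h3
      exact hadjj.symm
    · subst h4
      exact hadjj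
    · exact hp.adj_odd (by omega) h5
    · have := (hp.adj_odd (i := a - 1) (by omega) (by omega)).symm
      rwa [Nat.sub_add_cancel (by omega)] at this)
  obtain ⟨n', hn1, hn2⟩ := hm.exists_rematch (hp.mate_mem_image hm (I := I) (by
    intro a ha
    simp only [memI] at ha ⊢
    omega)) hn
  have h0 : 0 ∈ I := (memI 0).2 (Or.inl (Nat.zero_le _))
  have h1 : n' (f 0) = f i := by
    rw [hn2 ⟨0, h0, rfl⟩, hn' 0 h0]
    simp [σ]
  rw [huniq n' hn1, hp.mate_even (by omega) (by omega)] at h1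
  have := hp.inj (by omega) hi h1
  omega

/-- Uncrossed back edges at the two ends of an alternating path close two disjoint odd cycles;
outside them the path is matched by its edges not in `m`, and the remaining vertices by `m`. -/
theorem hasConformalOddCyclePair (hm : H.IsMate m) (hp : IsAltPath H m A k f) {i j : ℕ}
    (hi0 : i ≠ 0) (hi2 : i % 2 = 0) (hij : i < j) (hj : j < 2 * k) (hj2 : j % 2 = 1)
    (hadji : H.Adj (f 0) (f i)) (hadjj : H.Adj (f (2 * k + 1)) (f j)) :
    H.HasConformalOddCyclePair := by
  have hsub : ∀ a b : ℕ, b ≤ 2 * k + 1 → (Set.Icc a b).InjOn f := fun a b hb =>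
    hp.injOn.mono (Set.Icc_subset_Icc (Nat.zero_le _) hb)
  obtain ⟨C, hC, hCl, hCs⟩ := exists_isCycle_of_injOn (G := H) (a := 0) (b := i) (by omega)
    (hsub _ _ (by omega)) (fun c _ hc => hp.adj_succ hm (by omega)) hadji.symm
  obtain ⟨C', hC', hCl', hCs'⟩ := exists_isCycle_of_injOn (G := H) (a := j) (b := 2 * k + 1)
    (by omega) (hsub _ _ le_rfl) (fun c _ hc => hp.adj_succ hm (by omega)) hadjj
  refine ⟨_, _, C, C', hC, hC', ?_, ?_, ?_, ?_⟩
  · rw [hCl, Nat.odd_iff]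
    omega
  · rw [hCl', Nat.odd_iff]
    omega
  · intro v hv hv'
    rw [hCs] at hv
    rw [hCs'] at hv'
    obtain ⟨a, ha, rfl⟩ := hv
    obtain ⟨b, hb, hab⟩ := hv'
    simp only [Set.mem_Icc] at ha hb
    have := hp.inj (by omega) (by omega) hab
    omega
  · let σ : ℕ → ℕ := fun a => if a % 2 = 1 then a + 1 else a - 1
    obtain ⟨n, hn, -⟩ := exists_isMateOn_image (G := H) (σ := σ)
      (hsub (i + 1) (j - 1) (by omega)) (by
        intro a ha
        simp only [Set.mem_Icc] at ha ⊢
        refine ⟨by grind, by grind, ?_⟩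
        dsimp only [σ]
        split_ifs with h
        · exact hp.adj_odd (by omega) h
        · have := (hp.adj_odd (i := a - 1) (by omega) (by omega)).symm
          rwa [Nat.sub_add_cancel (by omega)] at this)
    have hcl := hp.mate_mem_image hm (I := Set.Icc 0 (2 * k + 1)) (by
      intro a ha
      simp only [Set.mem_Icc] at ha ⊢
      omega)
    have hc := hm.isMateOn_compl hcl
    obtain ⟨n', hn', -⟩ := hn.exists_union (disjoint_compl_right.mono_left
      (Set.image_mono (Set.Icc_subset_Icc (Nat.zero_le _) (by omega)))) hc
    have hset : {v | v ∉ C.support ∧ v ∉ C'.support} =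
        f '' Set.Icc (i + 1) (j - 1) ∪ (f '' Set.Icc 0 (2 * k + 1))ᶜ := by
      ext v
      change (v ∉ C.support ∧ v ∉ C'.support) ↔ _
      rw [hCs, hCs']
      by_cases hv : v ∈ f '' Set.Icc 0 (2 * k + 1)
      · obtain ⟨a, ha, rfl⟩ := hv
        have mem : ∀ c d, d ≤ 2 * k + 1 → (f a ∈ f '' Set.Icc c d ↔ c ≤ a ∧ a ≤ d) := by
          refine fun c d hd => ⟨?_, fun h => ⟨a, h, rfl⟩⟩
          rintro ⟨b, hb, hba⟩
          rw [← hp.inj (hb.2.trans hd) ha.2 hba]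
          exact hb
        rw [Set.mem_union, Set.mem_compl_iff, mem _ _ (by omega), mem _ _ le_rfl,
          mem _ _ (by omega), mem _ _ le_rfl]
        have := ha.2
        omega
      · have hv' : ∀ c d, d ≤ 2 * k + 1 → v ∉ f '' Set.Icc c d := fun c d hd h =>
          hv (Set.image_mono (Set.Icc_subset_Icc (Nat.zero_le _) hd) h)
        exact ⟨fun _ => Or.inr hv, fun _ => ⟨hv' _ _ (by omega), hv' _ _ le_rfl⟩⟩
    rw [hset]
    exact hn'.hasPerfectMatching_induce

end IsAltPath

/-- If the perfect matching `m` of `H` is unique and, inside a nonempty set `A` closed under `m`,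
every vertex has an edge not in `m`, then `H` contains a conformal pair of disjoint odd cycles. -/
theorem hasConformalOddCyclePair_of_unique [Finite V] (hm : H.IsMate m)
    (huniq : ∀ n, H.IsMate n → n = m) (hne : A.Nonempty) (hA : ∀ v ∈ A, m v ∈ A)
    (hA' : ∀ v ∈ A, ∃ z ∈ A, H.Adj v z ∧ z ≠ m v) : H.HasConformalOddCyclePair := by
  classical
  have hbound : ∀ k, (∃ f, IsAltPath H m A k f) → k ≤ Nat.card V := by
    rintro k ⟨f, hf⟩
    have h1 : (f '' Set.Icc 0 (2 * k + 1)).ncard = 2 * k + 2 := by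
      rw [hf.injOn.ncard_image, Set.ncard_eq_toFinset_card']
      simp
    have h2 := Set.ncard_le_card (f '' Set.Icc 0 (2 * k + 1))
    omega
  have h0 : ∃ f, IsAltPath H m A 0 f := by
    obtain ⟨v, hv⟩ := hne
    have hvm : v ≠ m v := (hm v).1.ne
    refine ⟨fun i => if i = 0 then v else m v, ?_, ?_, ?_, ?_⟩
    · intro i hi j hj h
      simp only [Set.mem_Icc] at hi hj
      grind
    · intro i _
      split_ifs
      exacts [hv, hA v hv]
    · intro i hi
      obtain rfl : i = 0 := by omega
      simp
    · intro i hi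
      omega
  let k := Nat.findGreatest (fun k => ∃ f, IsAltPath H m A k f) (Nat.card V)
  obtain ⟨f, hp⟩ : ∃ f, IsAltPath H m A k f :=
    Nat.findGreatest_spec (P := fun k => ∃ f, IsAltPath H m A k f) (Nat.zero_le _) h0
  have hmax : ¬ ∃ f, IsAltPath H m A (k + 1) f := fun h => by
    have : k + 1 ≤ k := Nat.le_findGreatest (hbound _ h) h
    omega
  obtain ⟨j, hj, hadjj⟩ := hp.exists_adj_last hm hA hA' hmax
  obtain ⟨i, hi, hadji⟩ := (hp.reverse hm).exists_adj_last hm hA hA' hmax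
  have hj2 := hp.odd_of_adj_last hm huniq hj hadjj
  have hi2 := (hp.reverse hm).odd_of_adj_last hm huniq hi hadji
  rw [Nat.sub_self] at hadji
  have hij := hp.lt_of_adj_of_adj hm huniq (i := 2 * k + 1 - i) (by omega) (by omega) hj hj2
    hadji hadjj
  exact hp.hasConformalOddCyclePair hm (by omega) (by omega) hij hj hj2 hadji hadjj

end Paths

/-! ### Forcing sets -/

section Forcing

variable {V : Type*} {G : SimpleGraph V} {m : V → V} {S : Set (Sym2 V)}

/-- `S` tells apart any two perfect matchings of `G`: distinct perfect matchings differ in an edge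
of `S`. Edges of `S` outside `G` are allowed, and are irrelevant. -/
def Forces (G : SimpleGraph V) (S : Set (Sym2 V)) : Prop :=
  ∀ m n : V → V, G.IsMate m → G.IsMate n →
    (∀ v, m v ≠ n v → s(v, m v) ∉ S ∧ s(v, n v) ∉ S) → m = n

theorem IsGlobalForcingSet.forces (h : G.IsGlobalForcingSet S) : G.Forces S := by
  intro m n hm hn hmn
  have aux : ∀ {m n : V → V} (hm : G.IsMate m) (hn : G.IsMate n),
      (∀ v, m v ≠ n v → s(v, m v) ∉ S) →
      hm.toSubgraph.edgeSet ∩ S ⊆ hn.toSubgraph.edgeSet ∩ S := by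
    rintro m n hm hn hmn e ⟨he, heS⟩
    obtain ⟨v, rfl⟩ := hm.mem_edgeSet.1 he
    refine ⟨hn.mem_edgeSet.2 ⟨v, ?_⟩, heS⟩
    by_contra hne
    exact hmn v (fun heq => hne (by rw [heq])) heS
  have := h.2 _ _ hm.isPerfectMatching hn.isPerfectMatching
    ((aux hm hn fun v hv => (hmn v hv).1).antisymm (aux hn hm fun v hv => (hmn v hv.symm).2))
  funext v
  have hv : hn.toSubgraph.Adj v (m v) := this ▸ (rfl : hm.toSubgraph.Adj v (m v))
  exact (show n v = m v from hv).symm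

/-- If every edge lies in a perfect matching, the vertices of degree at least two are closed
under adjacency. -/
theorem exists_two_adj_of_adj (hG : ∀ a b, G.Adj a b → ∃ n, G.IsMate n ∧ n a = b) {v w : V}
    (hvw : G.Adj v w) (hv : ∃ a b, G.Adj v a ∧ G.Adj v b ∧ a ≠ b) :
    ∃ a b, G.Adj w a ∧ G.Adj w b ∧ a ≠ b := by
  obtain ⟨a, ha, haw⟩ : ∃ a, G.Adj v a ∧ a ≠ w := by
    obtain ⟨a, b, ha, hb, hab⟩ := hv
    by_cases h : a = w
    · exact ⟨b, hb, fun hbw => hab (h.trans hbw.symm)⟩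
    · exact ⟨a, ha, h⟩
  obtain ⟨n, hn, hna⟩ := hG v a ha
  refine ⟨v, n w, hvw.symm, (hn w).1, fun h => haw ?_⟩
  rw [← hna, h, (hn w).2]

/-- The peeling vertex: some vertex of degree at least two has at most one edge outside a
forcing set. -/
theorem Forces.exists_degree_le_one [Finite V] (hS : G.Forces S) (hm : G.IsMate m)
    (hodd : ¬ G.HasConformalOddCyclePair)
    (hG : ∀ a b, G.Adj a b → ∃ n, G.IsMate n ∧ n a = b)
    (hne : ∃ v a b, G.Adj v a ∧ G.Adj v b ∧ a ≠ b) :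
    ∃ u, (∃ a b, G.Adj u a ∧ G.Adj u b ∧ a ≠ b) ∧
      ∀ a b, G.Adj u a → G.Adj u b → s(u, a) ∉ S → s(u, b) ∉ S → a = b := by
  by_contra! hcon
  -- Twice the number of edges of `n` outside `S` is maximized, each edge being counted at both
  -- of its ends.
  obtain ⟨n, hn, hmax⟩ := Set.exists_max_image {n | G.IsMate n}
    (fun n => {v | s(v, n v) ∉ S}.ncard) (Set.toFinite _) ⟨m, hm⟩
  let H : SimpleGraph V :=
    { Adj := fun a b => G.Adj a b ∧ (s(a, b) ∉ S ∨ n a = b)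
      symm := ⟨by
        rintro a b ⟨h1, h2⟩
        refine ⟨h1.symm, h2.imp (fun h => by rwa [Sym2.eq_swap]) ?_⟩
        rintro rfl
        exact (hn a).2⟩
      loopless := ⟨fun a h => h.1.ne rfl⟩ }
  have hHG : H ≤ G := fun a b h => h.1
  have hnH : H.IsMate n := fun v => ⟨⟨(hn v).1, Or.inr rfl⟩, (hn v).2⟩
  have huniq : ∀ n', H.IsMate n' → n' = n := by
    intro n' hn'
    have hsub : {v | s(v, n v) ∉ S} ⊆ {v | s(v, n' v) ∉ S} := by
      intro v hv
      rcases (hn' v).1.2 with h | h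
      · exact h
      · change s(v, n' v) ∉ S
        rw [← h]
        exact hv
    have heq := Set.eq_of_subset_of_ncard_le hsub (hmax n' (hn'.mono hHG))
    refine hS _ _ (hn'.mono hHG) hn fun v hv => ?_
    have h1 : s(v, n' v) ∉ S := (hn' v).1.2.resolve_right hv.symm
    have h2 : v ∈ {v | s(v, n v) ∉ S} := heq ▸ h1
    exact ⟨h1, h2⟩
  refine hodd (HasConformalOddCyclePair.mono hHG
    (hasConformalOddCyclePair_of_unique (A := {v | ∃ a b, G.Adj v a ∧ G.Adj v b ∧ a ≠ b})
      hnH huniq hne (fun v hv => exists_two_adj_of_adj hG (hn v).1 hv) fun v hv => ?_))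
  obtain ⟨a, b, ha, hb, haS, hbS, hab⟩ := hcon v hv
  by_cases h : a = n v
  · exact ⟨b, exists_two_adj_of_adj hG hb hv, ⟨hb, Or.inl hbS⟩, fun h' => hab (h.trans h'.symm)⟩
  · exact ⟨a, exists_two_adj_of_adj hG ha hv, ⟨ha, Or.inl haS⟩, h⟩

/-- A vertex with at most one edge outside `S` has at least `deg - 1` edges in `S`. -/
theorem ncard_star_diff_le [Finite V] {u w : V} (huw : G.Adj u w)
    (hu : ∀ a b, G.Adj u a → G.Adj u b → s(u, a) ∉ S → s(u, b) ∉ S → a = b) :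
    (G.incidenceSet u \ {s(u, w)}).ncard ≤ (S ∩ {e | u ∈ e}).ncard := by
  have h1 : (G.incidenceSet u \ {s(u, w)}).ncard + 1 = (G.incidenceSet u).ncard :=
    Set.ncard_sdiff_singleton_add_one ((G.mem_incidenceSet u w).2 huw)
  have h2 := Set.ncard_inter_add_ncard_sdiff_eq_ncard (G.incidenceSet u) S
  have h3 : (G.incidenceSet u \ S).ncard ≤ 1 := by
    rw [Set.ncard_le_one]
    intro e he e' he'
    obtain ⟨⟨heG, hue⟩, heS⟩ := he
    obtain ⟨⟨heG', hue'⟩, heS'⟩ := he'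
    obtain ⟨a, rfl⟩ := Sym2.mem_iff_exists.1 hue
    obtain ⟨b, rfl⟩ := Sym2.mem_iff_exists.1 hue'
    rw [hu a b heG heG' heS heS']
  have h4 : (G.incidenceSet u ∩ S).ncard ≤ (S ∩ {e | u ∈ e}).ncard :=
    Set.ncard_le_ncard fun e he => ⟨he.2, he.1.2⟩
  omega

/-- Once all edges at `u` but one are deleted, the forcing edges at `u` are superfluous. -/
theorem Forces.deleteEdges_star {u w : V} (hS : G.Forces S) :
    (G.deleteEdges (G.incidenceSet u \ {s(u, w)})).Forces (S \ {e | u ∈ e}) := by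
  intro n n' hn hn' h
  have hu : ∀ {n}, (G.deleteEdges (G.incidenceSet u \ {s(u, w)})).IsMate n → n u = w := by
    intro n hn
    have h1 := deleteEdges_adj.1 (hn u).1
    by_contra hne
    exact h1.2 ⟨(G.mem_incidenceSet u _).2 h1.1, fun h => hne (Sym2.congr_right.1 h)⟩
  have hle := G.deleteEdges_le (G.incidenceSet u \ {s(u, w)})
  refine hS n n' (hn.mono hle) (hn'.mono hle) fun v hv => ?_
  have aux : ∀ {n n' : V → V}, (G.deleteEdges (G.incidenceSet u \ {s(u, w)})).IsMate n →
      (G.deleteEdges (G.incidenceSet u \ {s(u, w)})).IsMate n' → n v ≠ n' v → u ∉ s(v, n v) := by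
    intro n n' hn hn' hne hmem
    rcases Sym2.mem_iff.1 hmem with rfl | hv
    · exact hne ((hu hn).trans (hu hn').symm)
    · have hvw : v = w := by rw [← hu hn, hv, (hn v).2]
      exact hne (by rw [← hv, hvw, ← hu hn', (hn' u).2])
  exact ⟨fun hm => (h v hv).1 ⟨hm, aux hn hn' hv⟩, fun hm => (h v hv).2 ⟨hm, aux hn' hn hv.symm⟩⟩

/-- For each perfect matching `m`, a set forcing all perfect matchings of `G` can be traded for
an anti-forcing set `R` of `m` that is no larger. The induction deletes an edge that lies in no
perfect matching, or peels off the edges at a vertex with at most one edge outside `S`. -/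
theorem exists_antiforcing_of_forcing [Finite V] (G : SimpleGraph V) (S : Set (Sym2 V))
    (hS : G.Forces S) (hm : G.IsMate m) (hodd : ¬ G.HasConformalOddCyclePair) :
    ∃ R ⊆ G.edgeSet, (∀ v, s(v, m v) ∉ R) ∧ R.ncard ≤ S.ncard ∧
      ∀ n, (G.deleteEdges R).IsMate n → n = m := by
  induction hk : G.edgeSet.ncard using Nat.strong_induction_on generalizing G S with
  | _ k ih =>
  subst hk
  by_cases hG : ∀ a b, G.Adj a b → ∃ n, G.IsMate n ∧ n a = b
  · by_cases hne : ∃ v a b, G.Adj v a ∧ G.Adj v b ∧ a ≠ b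
    · obtain ⟨u, ⟨a, b, ha, hb, hab⟩, hu⟩ := hS.exists_degree_le_one hm hodd hG hne
      let D := G.incidenceSet u \ {s(u, m u)}
      have hDG : D ⊆ G.edgeSet := fun e he => he.1.1
      have hmD : ∀ v, s(v, m v) ∉ D := by
        rintro v ⟨⟨-, h⟩, h'⟩
        rcases Sym2.mem_iff.1 h with rfl | h
        · exact h' rfl
        · exact h' (by rw [h, (hm v).2, Sym2.eq_swap]; rfl)
      obtain ⟨x, hx, hxm⟩ : ∃ x, G.Adj u x ∧ x ≠ m u := by
        by_cases h : a = m u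
        · exact ⟨b, hb, fun h' => hab (h.trans h'.symm)⟩
        · exact ⟨a, ha, h⟩
      have hxD : s(u, x) ∈ D :=
        ⟨(G.mem_incidenceSet u x).2 hx, fun h => hxm (Sym2.congr_right.1 h)⟩
      have hlt : (G.deleteEdges D).edgeSet.ncard < G.edgeSet.ncard := by
        rw [edgeSet_deleteEdges]
        exact Set.ncard_lt_ncard ⟨Set.sdiff_subset, fun h => (h (hDG hxD)).2 hxD⟩
      obtain ⟨R, hRG, hmR, hcard, hR⟩ := ih _ hlt (G.deleteEdges D) (S \ {e | u ∈ e})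
        hS.deleteEdges_star
        (fun v => ⟨deleteEdges_adj.2 ⟨(hm v).1, hmD v⟩, (hm v).2⟩)
        (fun h => hodd (h.mono (G.deleteEdges_le D))) rfl
      rw [edgeSet_deleteEdges] at hRG
      refine ⟨D ∪ R, Set.union_subset hDG (hRG.trans Set.sdiff_subset), ?_, ?_, ?_⟩
      · rintro v (h | h)
        exacts [hmD v h, hmR v h]
      · have h1 := Set.ncard_union_le D R
        have h2 : D.ncard ≤ _ := ncard_star_diff_le (hm u).1 hu
        have h3 := Set.ncard_inter_add_ncard_sdiff_eq_ncard S {e | u ∈ e}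
        omega
      · intro n hn
        exact hR n (by rwa [deleteEdges_deleteEdges])
    · -- All degrees are at most one, so `G` consists of the edges of `m`.
      push Not at hne
      refine ⟨∅, Set.empty_subset _, fun v => Set.notMem_empty _, by simp, fun n hn => ?_⟩
      rw [deleteEdges_empty] at hn
      funext v
      exact hne v _ _ (hn v).1 (hm v).1
  · push Not at hG
    obtain ⟨a, b, hab, hno⟩ := hG
    have hmate : ∀ {n}, G.IsMate n → ∀ v, s(v, n v) ≠ s(a, b) := by
      intro n hn v h
      rcases Sym2.eq_iff.1 h with ⟨rfl, h'⟩ | ⟨rfl, h'⟩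
      · exact hno n hn h'
      · exact hno n hn (by rw [← h', (hn v).2])
    have hdel : ∀ {n}, G.IsMate n → (G.deleteEdges {s(a, b)}).IsMate n := fun hn v =>
      ⟨deleteEdges_adj.2 ⟨(hn v).1, hmate hn v⟩, (hn v).2⟩
    have hle := G.deleteEdges_le {s(a, b)}
    have hlt : (G.deleteEdges {s(a, b)}).edgeSet.ncard < G.edgeSet.ncard := by
      rw [edgeSet_deleteEdges]
      exact Set.ncard_sdiff_singleton_lt_of_mem hab
    obtain ⟨R, hRG, hmR, hcard, hR⟩ := ih _ hlt _ S
      (fun n n' hn hn' => hS n n' (hn.mono hle) (hn'.mono hle)) (hdel hm)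
      (fun h => hodd (h.mono hle)) rfl
    rw [edgeSet_deleteEdges] at hRG
    refine ⟨R, hRG.trans Set.sdiff_subset, hmR, hcard, fun n hn => hR n fun v => ?_⟩
    have h1 := deleteEdges_adj.1 (hn v).1
    exact ⟨deleteEdges_adj.2 ⟨(hdel (hn.mono (G.deleteEdges_le R)) v).1, h1.2⟩, (hn v).2⟩

theorem isAntiForcingSet_of_isMate {M : G.Subgraph} {R : Set (Sym2 V)}
    (hMm : ∀ a b, M.Adj a b ↔ m a = b) (hm : G.IsMate m) (hRG : R ⊆ G.edgeSet)
    (hmR : ∀ v, s(v, m v) ∉ R) (hR : ∀ n, (G.deleteEdges R).IsMate n → n = m) :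
    G.IsAntiForcingSet M R := by
  refine ⟨fun e he => ⟨hRG he, fun heM => ?_⟩, ?_⟩
  · induction e with
    | h a b =>
      obtain rfl := (hMm a b).1 heM
      exact hmR a he
  · have hmR' : (G.deleteEdges R).IsMate m := fun v =>
      ⟨deleteEdges_adj.2 ⟨(hm v).1, hmR v⟩, (hm v).2⟩
    refine ⟨hmR'.toSubgraph, hmR'.isPerfectMatching, fun N hN => ?_⟩
    obtain ⟨n, hn, hNn⟩ := hN.exists_isMate
    obtain rfl := hR n hn
    refine Subgraph.ext hN.2.verts_eq_univ ?_
    funext a b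
    exact propext (hNn a b)

end Forcing

end SimpleGraph

theorem mainTheorem1 {V : Type*} [Finite V] (G : SimpleGraph V) (hG : G.InClassG) :
    G.maxAntiForcingNumber ≤ G.globalForcingNumber := by
  obtain ⟨S, hS, hcard⟩ := Nat.sInf_mem
    (⟨_, G.edgeSet, G.isGlobalForcingSet_edgeSet, rfl⟩ :
      {k : ℕ | ∃ S : Set (Sym2 V), G.IsGlobalForcingSet S ∧ S.ncard = k}.Nonempty)
  refine csSup_le' ?_
  rintro _ ⟨M, hM, rfl⟩
  obtain ⟨m, hm, hMm⟩ := hM.exists_isMate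
  obtain ⟨R, hRG, hmR, hRS, hR⟩ := SimpleGraph.exists_antiforcing_of_forcing G S hS.forces hm hG.2
  calc G.antiForcingNumber M ≤ R.ncard :=
        Nat.sInf_le ⟨R, SimpleGraph.isAntiForcingSet_of_isMate hMm hm hRG hmR hR, rfl⟩
    _ ≤ S.ncard := hRS
    _ = G.globalForcingNumber := hcard
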